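/- Let $\Phi_0,\Phi_1,\dots$ be a standard enumeration of the computable (partial) functionals $\Phi_e:\subseteq\mathbb N^{\mathbb N}\to\mathbb N^{\mathbb N}$. For $A,B\subseteq\mathbb N^{\mathbb N}$ write $A\le_{\mathrm M}B$ (Medvedev reducibility) if some computable functional is defined on all of $B$ and maps $B$ into $A$. For $p\in\mathbb N^{\mathbb N}$ let $$p^+:=\{\,\langle e\rangle^\frown q \;:\; e\in\mathbb N,\ q\in\mathbb N^{\mathbb N},\ \Phi_e(q)=p \text{ and } q\not\le_{\mathrm T}p\,\},$$ where $\langle e\rangle^\frown q$ is the sequence with first term $e$ followed by the terms of $q$, and $\le_{\mathrm T}$ is Turing reducibility. A partial multi-valued function $f$ on Baire space assigns to each $p\in\mathbb N^{\mathbb N}$ a set $f(p)\subseteq\mathbb N^{\mathbb N}$; its domain is $\operatorname{dom}(f)=\{p: f(p)\neq\emptyset\}$. For two such functions, $f\le_{\mathrm W}g$ (Weihrauch reducibility) means that there are computable functionals $\Phi:\subseteq\mathbb N^{\mathbb N}\to\mathbb N^{\mathbb N}$ and $\Psi:\subseteq\mathbb N^{\mathbb N}\times\mathbb N^{\mathbb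 N}\to\mathbb N^{\mathbb N}$ such that for every $p\in\operatorname{dom}(f)$ we have $\Phi(p)\in\operatorname{dom}(g)$ and $\Psi(p,q)\in f(p)$ for all $q\in g(\Phi(p))$. Write $f\equiv_{\mathrm W}g$ if $f\le_{\mathrm W}g$ and $g\le_{\mathrm W}f$, and $f<_{\mathrm W}g$ if $f\le_{\mathrm W}g$ and $g\not\le_{\mathrm W}f$. Call $f$ a minimal cover of $h$ in the Weihrauch degrees if $h<_{\mathrm W}f$ and there is no $g$ with $h<_{\mathrm W}g<_{\mathrm W}f$. The join $f\sqcup g$ has domain $\{0\}\times\operatorname{dom}(f)\cup\{1\}\times\operatorname{dom}(g)$ and is given by $(f\sqcup g)(0,x)=f(x)$, $(f\sqcup g)(1,x)=g(x)$, where a number is identified with the constant sequence of that value and pairs of sequences are coded as sequences in the usual way. For $A\subseteq\mathbb N^{\mathbb N}$, $\mathrm{id}|_A$ is the identity function restricted to $A$. **Theorem.** Let $f$ and $h$ be partial multi-valued functions on Baire space. The following are equivalent: 1. $f$ is a minimal cover of $h$ in the Weihrauch degrees. 2. There is $p\in\mathbb N^{\mathbb N}$ such that $f\equiv_{\mathrm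 W}h\sqcup\mathrm{id}|_{\{p\}}$, $\operatorname{dom}(h)\not\le_{\mathrm M}\{p\}$ and $\operatorname{dom}(h)\le_{\mathrm M}p^+$. -/

import Mathlib

/-- Baire space `ℕ^ℕ`. -/
abbrev Baire : Type := ℕ → ℕ

namespace Baire

/-- The code `⟨p, q⟩` of a pair of points: `p` on the even and `q` on the odd positions. -/
def pair (p q : Baire) : Baire := fun n => if n % 2 = 0 then p (n / 2) else q (n / 2)

/-- The constant sequence with value `n`, which represents the number `n`. -/
def const (n : ℕ) : Baire := fun _ => n

/-- The sequence `e ⌢ q`: first the number `e`, then the terms of `q`. -/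
def cons (e : ℕ) (q : Baire) : Baire
  | 0 => e
  | n + 1 => q n

/-- The finite initial segment `p(0), …, p(k - 1)`. -/
def initSeg (p : Baire) (k : ℕ) : List ℕ := (List.range k).map p

/-- Turing reducibility `q ≤_T p` between points of Baire space (Mathlib's notion for the total
functions `q` and `p`). -/
def TuringLE (q p : Baire) : Prop := TuringReducible (q : ℕ →. ℕ) (p : ℕ →. ℕ)

end Baire

/-- The answer of the `e`-th program to the argument `n` and the finite piece `s` of the oracle:
undefined if the program does not halt, `0` for "a longer piece of the oracle is needed", and
`v + 1` for "the output is `v`". -/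
def oracleAnswer (e n : ℕ) (s : List ℕ) : Part ℕ :=
  (Denumerable.ofNat Nat.Partrec.Code e).eval (Encodable.encode (n, s))

/-- The partial function `n ↦ Φ_e(p)(n)` computed by the `e`-th program with oracle `p`: the
program is run on `n` and on the initial segments of `p` of length `k = 0, 1, 2, …`, until it
gives a nonzero answer `v + 1`; then the output is `v`. -/
def oracleEval (e : ℕ) (p : Baire) : ℕ →. ℕ := fun n =>
  (Nat.rfind fun k => (oracleAnswer e n (p.initSeg k)).map fun v => decide (v ≠ 0)).bind fun k =>
    (oracleAnswer e n (p.initSeg k)).map Nat.pred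

/-- The `e`-th computable functional `Φ_e :⊆ ℕ^ℕ → ℕ^ℕ`. It is defined at `p` iff the `e`-th program
with oracle `p` gives an output for every `n`. -/
def functional (e : ℕ) : Baire →. Baire := fun p =>
  ⟨∀ n, (oracleEval e p n).Dom, fun H n => (oracleEval e p n).get (H n)⟩

/-- Medvedev reducibility `A ≤_M B`: some computable functional is defined on all of `B` and maps `B`
into `A`. -/
def MedvedevLE (A B : Set Baire) : Prop :=
  ∃ e : ℕ, ∀ b ∈ B, ∃ a ∈ functional e b, a ∈ A

/-- The Medvedev successor `p⁺ = {e ⌢ q | Φ_e(q) = p and q ≰_T p}` of `{p}`. -/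
def medvedevSucc (p : Baire) : Set Baire :=
  {z | ∃ (e : ℕ) (q : Baire), z = Baire.cons e q ∧ p ∈ functional e q ∧ ¬ Baire.TuringLE q p}

/-- A problem is a partial multi-valued function on Baire space, given by its sets of values;
`f p = ∅` means that `f` is not defined at `p`. -/
abbrev Problem : Type := Baire → Set Baire

namespace Problem

/-- The domain of a partial multi-valued function. -/
def dom (f : Problem) : Set Baire := {p | (f p).Nonempty}

/-- Weihrauch reducibility `f ≤_W g`: there are computable functionals `Φ` and `Ψ` such that, for every
`p ∈ dom f`, `Φ(p) ∈ dom g` and `Ψ(p, q) ∈ f(p)` for all `q ∈ g(Φ(p))`. -/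
def WeihrauchLE (f g : Problem) : Prop :=
  ∃ d e : ℕ, ∀ p ∈ f.dom, ∃ r ∈ functional d p, r ∈ g.dom ∧
    ∀ q ∈ g r, ∃ y ∈ functional e (Baire.pair p q), y ∈ f p

/-- Strict Weihrauch reducibility `f <_W g`. -/
def WeihrauchLT (f g : Problem) : Prop := f.WeihrauchLE g ∧ ¬ g.WeihrauchLE f

/-- Weihrauch equivalence `f ≡_W g`. -/
def WeihrauchEquiv (f g : Problem) : Prop := f.WeihrauchLE g ∧ g.WeihrauchLE f

/-- The degree of `f` is a minimal cover of the degree of `h` in the Weihrauch degrees: `h <_W f`, and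
there is no `g` with `h <_W g <_W f`. -/
def IsMinimalCover (f h : Problem) : Prop :=
  h.WeihrauchLT f ∧ ¬ ∃ g : Problem, h.WeihrauchLT g ∧ g.WeihrauchLT f

/-- The join `f ⊔ g`, with domain `{0} × dom f ∪ {1} × dom g`, defined by `(f ⊔ g)(0, x) = f(x)` and
`(f ⊔ g)(1, x) = g(x)`. -/
def join (f g : Problem) : Problem := fun z =>
  {y | (∃ x, z = Baire.pair (Baire.const 0) x ∧ y ∈ f x) ∨
    (∃ x, z = Baire.pair (Baire.const 1) x ∧ y ∈ g x)}

/-- The restriction `id|A` of the identity function to the set `A`. -/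
def idRestrict (A : Set Baire) : Problem := fun p => {q | p ∈ A ∧ q = p}

end Problem

/-! Throughout, `f.restrict x` is `f` on the single instance `x`. Everything rests on a dichotomy
for a minimal cover `f` of `h` (`IsMinimalCover.le_or_le_join`): if `g ≤ f`, then `h ⊔ g` lies
between `h` and `f`, so `g ≤ h` or `f ≤ h ⊔ g`.

From (2) to (1): let `h ≤ g ≤ h ⊔ id|{p}`. If `p` computes an instance of `g`, then `id|{p} ≤ g`, so
`g` is at the top. Otherwise every instance `x` of `g` that is sent to `p` computes `p` without
being computable from it. With an index it is then a point of `p⁺`, so it yields an instance of `h`,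
and `g ≤ h`.

From (1) to (2), the dichotomy is applied to three problems below `f`. Some single instance `x`
satisfies `f.restrict x ≰ h` (`exists_restrict`): otherwise a stagewise diagonalization selects
tagged instances of `f` forming a problem `g ≤ f` with `g ≰ h` and `f ≰ h ⊔ g`. Such an `x` computes
no instance of `h` (`not_medvedevLE`): adding a constant solution to each copy `n ⌢ x` gives a
problem that is still not below `h`, but each of whose instances has a computable solution. Such a
problem cannot help to solve `x`. Hence `id|{x} ≰ h`, so `f ≡ h ⊔ id|{x}`. Finally `id|x⁺ ≤ id|{x}`,
and `f ≤ h ⊔ id|x⁺` would make `x` compute an instance of `h` or a point of `x⁺`. This leaves `id|x⁺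
≤ h`. -/

section

open Filter Encodable

/-! ### Programs with oracle as monotone partial recursive use functions. -/

namespace Baire

theorem initSeg_length (p : Baire) (k : ℕ) : (p.initSeg k).length = k := by simp [initSeg]

theorem initSeg_succ (p : Baire) (k : ℕ) : p.initSeg (k + 1) = p.initSeg k ++ [p k] := by
  simp [initSeg, List.range_succ]

theorem initSeg_take (p : Baire) {j k : ℕ} (h : j ≤ k) : (p.initSeg k).take j = p.initSeg j := by
  simp [initSeg, ← List.map_take, List.take_range, h]

theorem initSeg_prefix (p : Baire) {j k : ℕ} (h : j ≤ k) : p.initSeg j <+: p.initSeg k := by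
  rw [← p.initSeg_take h]; exact List.take_prefix _ _

theorem initSeg_getElem? (p : Baire) {n k : ℕ} (h : n < k) : (p.initSeg k)[n]? = some (p n) := by
  simp [initSeg, h]

end Baire

theorem mem_rfind_iff {P : ℕ → Part Bool} {n : ℕ} :
    n ∈ Nat.rfind P ↔ true ∈ P n ∧ ∀ m < n, false ∈ P m :=
  ⟨fun h => ⟨(Nat.mem_rfind.1 h).1, fun _ hm => (Nat.mem_rfind.1 h).2 hm⟩,
    fun h => Nat.mem_rfind.2 ⟨h.1, fun {_} hm => h.2 _ hm⟩⟩

/-- The value `v` for which `v + 1` is the first nonzero value of a partial sequence. -/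
def firstPositive (A : ℕ → Part ℕ) : Part ℕ :=
  (Nat.rfind fun k => (A k).map fun v => decide (v ≠ 0)).bind fun k => (A k).map Nat.pred

theorem mem_firstPositive {A : ℕ → Part ℕ} {v : ℕ} :
    v ∈ firstPositive A ↔ ∃ k, v + 1 ∈ A k ∧ ∀ j < k, 0 ∈ A j := by
  simp only [firstPositive, Part.mem_bind_iff, mem_rfind_iff, Part.mem_map_iff]
  constructor
  · rintro ⟨k, ⟨⟨w, hw, hw0⟩, hj⟩, u, hu, rfl⟩
    obtain rfl := Part.mem_unique hw hu
    have : w ≠ 0 := by simpa using hw0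
    refine ⟨k, ?_, fun j hjk => ?_⟩
    · rwa [Nat.pred_eq_sub_one, Nat.sub_add_cancel (Nat.pos_of_ne_zero this)]
    · obtain ⟨z, hz, hz0⟩ := hj j hjk
      have : z = 0 := by simpa using hz0
      rwa [this] at hz
  · rintro ⟨k, hk, hj⟩
    exact ⟨k, ⟨⟨_, hk, by simp⟩, fun j hjk => ⟨0, hj j hjk, by simp⟩⟩, _, hk, rfl⟩

theorem oracleEval_eq (e : ℕ) (p : Baire) (n : ℕ) :
    oracleEval e p n = firstPositive fun k => oracleAnswer e n (p.initSeg k) := rfl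

theorem mem_functional {e : ℕ} {p q : Baire} :
    q ∈ functional e p ↔ ∀ n, q n ∈ oracleEval e p n := by
  constructor
  · rintro ⟨H, rfl⟩ n
    exact Part.get_mem (H n)
  · intro h
    exact ⟨fun n => Part.dom_iff_mem.2 ⟨_, h n⟩,
      funext fun n => Part.get_eq_of_mem (h n) (Part.dom_iff_mem.2 ⟨_, h n⟩)⟩

/-- A partial recursive function of a finite piece of the oracle and an argument which keeps its
values when the piece of the oracle is extended. -/
structure IsUseFunction (H : List ℕ × ℕ →. ℕ) : Prop where
  partrec : Partrec H
  mono : ∀ {s t : List ℕ} {n v : ℕ}, s <+: t → v ∈ H (s, n) → v ∈ H (t, n)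

/-- The value `v` at `n` is obtained by `H` from the oracle `p`. -/
def UseComputes (H : List ℕ × ℕ →. ℕ) (p : Baire) (n v : ℕ) : Prop :=
  ∀ᶠ k in atTop, v ∈ H (p.initSeg k, n)

namespace IsUseFunction

variable {H K : List ℕ × ℕ →. ℕ} {p q : Baire} {n v : ℕ}

theorem useComputes (hH : IsUseFunction H) {k : ℕ} (h : v ∈ H (p.initSeg k, n)) :
    UseComputes H p n v :=
  eventually_atTop.2 ⟨k, fun _ hj => hH.mono (p.initSeg_prefix hj) h⟩

/-- The search in `oracleEval` gets stuck on a diverging answer, while `H` may diverge on short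
pieces of the oracle. The program is therefore made total: a piece of length `m = Nat.pair k t` is
used to simulate `H` for `t` steps on its first `k` entries. -/
theorem exists_functional (hH : IsUseFunction H) :
    ∃ e, ∀ p q : Baire, (∀ n, UseComputes H p n (q n)) → q ∈ functional e p := by
  obtain ⟨c, hc⟩ := Nat.Partrec.Code.exists_code.1 hH.partrec
  have hc' : ∀ s n, c.eval (encode (s, n)) = H (s, n) := by
    intro s n
    rw [hc]
    simp only [encodek, Part.coe_some, Part.bind_some]
    exact Part.map_id' (fun _ => rfl) _
  -- The default `0` asks for a longer piece; `Nat.succ` marks a genuine output.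
  let F : ℕ × List ℕ → ℕ := fun a =>
    ((Nat.Partrec.Code.evaln a.2.length.unpair.2 c
      (encode (a.2.take a.2.length.unpair.1, a.1))).map Nat.succ).getD 0
  have hF : Computable F := by
    have h1 : Computable fun a : ℕ × List ℕ => a.2.length.unpair :=
      Computable.unpair.comp (Computable.list_length.comp Computable.snd)
    have h2 : Computable fun a : ℕ × List ℕ => (a.2.take a.2.length.unpair.1, a.1) :=
      (Primrec.list_take.to_comp.comp (Computable.fst.comp h1) Computable.snd).pair Computable.fst
    exact Computable.option_getD (Computable.option_map (Nat.Partrec.Code.primrec_evaln.to_comp.comp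
      (((Computable.snd.comp h1).pair (Computable.const c)).pair (Computable.encode.comp h2)))
      (Computable.succ.comp Computable.snd).to₂) (Computable.const 0)
  obtain ⟨d, hd⟩ := Nat.Partrec.Code.exists_code.1 hF
  have hd' : ∀ n s, oracleAnswer (encode d) n s = Part.some (F (n, s)) := by
    intro n s
    simp [oracleAnswer, hd]
  refine ⟨encode d, fun p q h => mem_functional.2 fun n => ?_⟩
  rw [oracleEval_eq, mem_firstPositive]
  simp only [hd', Part.mem_some_iff]
  obtain ⟨k, hk⟩ := (h n).exists
  rw [← hc', Nat.Partrec.Code.evaln_complete] at hk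
  obtain ⟨t, ht⟩ := hk
  have hex : ∃ m, F (n, p.initSeg m) ≠ 0 := by
    refine ⟨Nat.pair k t, ?_⟩
    simp only [F, Baire.initSeg_length, Nat.unpair_pair]
    rw [p.initSeg_take (Nat.left_le_pair k t), Option.mem_def.1 ht]
    simp
  classical
  refine ⟨Nat.find hex, ?_, fun j hj => (not_not.1 (Nat.find_min hex hj)).symm⟩
  have hne := Nat.find_spec hex
  generalize Nat.find hex = m at hne
  simp only [F, Baire.initSeg_length] at hne ⊢
  rw [p.initSeg_take (Nat.unpair_left_le m)] at hne ⊢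
  cases hev : Nat.Partrec.Code.evaln m.unpair.2 c (encode (p.initSeg m.unpair.1, n)) with
  | none => rw [hev] at hne; exact absurd rfl hne
  | some w =>
    have hw : w ∈ H (p.initSeg m.unpair.1, n) := by
      rw [← hc']; exact Nat.Partrec.Code.evaln_sound hev
    -- The value found first may come from another piece than the expected one; monotonicity
    -- compares both on a common longer piece.
    obtain ⟨i, hi, hi'⟩ := ((hH.useComputes hw).and (h n)).exists
    simp [Part.mem_unique hi hi']

theorem of_computable {f : ℕ → ℕ} (hf : Computable f) :
    IsUseFunction fun a => Part.some (f a.2) :=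
  ⟨(hf.comp Computable.snd).partrec, fun _ h => h⟩

theorem oracle {f : ℕ → ℕ} (hf : Computable f) :
    IsUseFunction fun a => (a.1[f a.2]? : Option ℕ) := by
  refine ⟨(Computable.list_getElem?.comp Computable.fst (hf.comp Computable.snd)).ofOption, ?_⟩
  rintro s t n v ⟨u, rfl⟩ h
  simp only [Part.mem_ofOption, Option.mem_def] at h ⊢
  rw [List.getElem?_append_left (List.getElem?_eq_some_iff.1 h).1, h]

theorem useComputes_oracle (f : ℕ → ℕ) :
    UseComputes (fun a => (a.1[f a.2]? : Option ℕ)) p n (p (f n)) := by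
  filter_upwards [eventually_gt_atTop (f n)] with k hk
  simp [p.initSeg_getElem? hk]

theorem pair (hH : IsUseFunction H) (hK : IsUseFunction K) :
    IsUseFunction fun a => Nat.pair <$> H a <*> K a := by
  refine ⟨(hH.partrec.bind ((hK.partrec.comp Computable.fst).map
    (Primrec₂.natPair.to_comp.comp (Computable.snd.comp Computable.fst)
      Computable.snd).to₂).to₂).of_eq fun a => by simp [Seq.seq, Part.bind_map], ?_⟩
  intro s t n v hst hv
  simp only [Seq.seq, Part.map_eq_map, Part.mem_bind_iff, Part.mem_map_iff] at hv ⊢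
  obtain ⟨_, ⟨x, hx, rfl⟩, y, hy, rfl⟩ := hv
  exact ⟨_, ⟨x, hH.mono hst hx, rfl⟩, y, hK.mono hst hy, rfl⟩

theorem comp (hH : IsUseFunction H) (hK : IsUseFunction K) :
    IsUseFunction fun a => K a >>= fun m => H (a.1, m) := by
  refine ⟨hK.partrec.bind (hH.partrec.comp
    ((Computable.fst.comp Computable.fst).pair Computable.snd)).to₂, ?_⟩
  intro s t n v hst hv
  simp only [Part.bind_eq_bind, Part.mem_bind_iff] at hv ⊢
  obtain ⟨x, hx, hv⟩ := hv
  exact ⟨x, hK.mono hst hx, hH.mono hst hv⟩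

theorem prec (hH : IsUseFunction H) (hK : IsUseFunction K) :
    IsUseFunction fun a => Nat.rec (H (a.1, a.2.unpair.1))
      (fun y IH => IH.bind fun i => K (a.1, Nat.pair a.2.unpair.1 (Nat.pair y i)))
      a.2.unpair.2 := by
  have hu : Computable fun a : List ℕ × ℕ => a.2.unpair := Computable.unpair.comp Computable.snd
  refine ⟨Partrec.nat_rec (Computable.snd.comp hu) (hH.partrec.comp
      (Computable.fst.pair (Computable.fst.comp hu)))
    (hK.partrec.comp ((Computable.fst.comp Computable.fst).pair
      (Primrec₂.natPair.to_comp.comp (Computable.fst.comp (hu.comp Computable.fst))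
        (Primrec₂.natPair.to_comp.comp (Computable.fst.comp Computable.snd)
          (Computable.snd.comp Computable.snd))))).to₂, ?_⟩
  intro s t n v hst
  dsimp only
  generalize n.unpair.2 = m
  induction m generalizing v with
  | zero => exact hH.mono hst
  | succ m ih =>
    simp only [Part.mem_bind_iff]
    rintro ⟨i, hi, hv⟩
    exact ⟨i, ih hi, hK.mono hst hv⟩

theorem rfind (hH : IsUseFunction H) :
    IsUseFunction fun a => Nat.rfind fun n => (fun m => m = 0) <$> H (a.1, Nat.pair a.2 n) := by
  refine ⟨Partrec.rfind (((hH.partrec.comp ((Computable.fst.comp Computable.fst).pair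
    (Primrec₂.natPair.to_comp.comp (Computable.snd.comp Computable.fst) Computable.snd))).map
    (Primrec.eq.decide.to_comp.comp Computable.snd (Computable.const 0)).to₂).to₂), ?_⟩
  intro s t n v hst hv
  simp only [mem_rfind_iff, Part.map_eq_map, Part.mem_map_iff] at hv ⊢
  obtain ⟨⟨x, hx, hx0⟩, hv⟩ := hv
  refine ⟨⟨x, hH.mono hst hx, hx0⟩, fun m hm => ?_⟩
  obtain ⟨y, hy, hy0⟩ := hv m hm
  exact ⟨y, hH.mono hst hy, hy0⟩

end IsUseFunction

end

/-! ### Composition of functionals, and agreement with Turing reducibility. -/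

section

open Filter Encodable

theorem partrec_oracleAnswer :
    Partrec fun a : ℕ × ℕ × List ℕ => oracleAnswer a.1 a.2.1 a.2.2 :=
  Nat.Partrec.Code.eval_part.comp ((Computable.ofNat Nat.Partrec.Code).comp Computable.fst)
    (Computable.encode.comp Computable.snd)

/-- The list of the first `k` values of a use function on a finite piece of the oracle. -/
def useValues (H : List ℕ × ℕ →. ℕ) (s : List ℕ) (k : ℕ) : Part (List ℕ) :=
  Nat.rec (Part.some []) (fun j IH => IH.bind fun l => (H (s, j)).map fun v => l ++ [v]) k

theorem useValues_succ (H : List ℕ × ℕ →. ℕ) (s : List ℕ) (k : ℕ) :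
    useValues H s (k + 1) = (useValues H s k).bind fun l => (H (s, k)).map fun v => l ++ [v] := rfl

theorem useValues_eq {H : List ℕ × ℕ →. ℕ} {s : List ℕ} {q : Baire} {k : ℕ}
    (h : ∀ j < k, q j ∈ H (s, j)) : q.initSeg k ∈ useValues H s k := by
  induction k with
  | zero => exact Part.mem_some _
  | succ k ih =>
    rw [useValues_succ, q.initSeg_succ]
    exact Part.mem_bind (ih fun j hj => h j (hj.trans (Nat.lt_succ_self k)))
      (Part.mem_map _ (h k (Nat.lt_succ_self k)))

namespace IsUseFunction

variable {H K : List ℕ × ℕ →. ℕ} {p q r : Baire} {n v : ℕ}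

theorem partrec_useValues (hH : IsUseFunction H) :
    Partrec fun a : List ℕ × ℕ => useValues H a.1 a.2 :=
  Partrec.nat_rec Computable.snd (Computable.const []).partrec
    ((hH.partrec.comp ((Computable.fst.comp Computable.fst).pair
      (Computable.fst.comp Computable.snd))).map
      (Computable.list_concat.comp (Computable.snd.comp (Computable.snd.comp Computable.fst))
        Computable.snd).to₂).to₂

theorem useValues_mono (hH : IsUseFunction H) {s t : List ℕ} (hst : s <+: t) {k : ℕ} {l : List ℕ}
    (h : l ∈ useValues H s k) : l ∈ useValues H t k := by
  induction k generalizing l with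
  | zero => exact h
  | succ k ih =>
    rw [useValues_succ] at h ⊢
    simp only [Part.mem_bind_iff, Part.mem_map_iff] at h ⊢
    obtain ⟨l, hl, v, hv, rfl⟩ := h
    exact ⟨l, ih hl, v, hH.mono hst hv, rfl⟩

/-- The use function of the composition of a use function with a program, which is itself obtained
from the oracle. -/
theorem exists_functional_comp {E : List ℕ × ℕ →. ℕ} (hE : IsUseFunction E)
    (hH : IsUseFunction H) :
    ∃ K, IsUseFunction K ∧ ∀ (e : ℕ) (p q r : Baire), (∀ n, UseComputes E p n e) →
      (∀ n, UseComputes H p n (q n)) → r ∈ functional e q → ∀ n, UseComputes K p n (r n) := by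
  -- The answer of program `e` on the first `k` values of the intermediate point, all recomputed
  -- from the one piece `s` of the oracle.
  let A : List ℕ → ℕ → ℕ → Part ℕ := fun s n k =>
    (E (s, n)).bind fun e => (useValues H s k).bind fun l => oracleAnswer e n l
  have hA : Partrec₂ fun (a : List ℕ × ℕ) (k : ℕ) => A a.1 a.2 k := by
    have h1 : Partrec fun b : (List ℕ × ℕ) × ℕ => E b.1 := hE.partrec.comp Computable.fst
    have h2 : Partrec fun b : ((List ℕ × ℕ) × ℕ) × ℕ => useValues H b.1.1.1 b.1.2 :=
      Partrec.comp (f := fun a : List ℕ × ℕ => useValues H a.1 a.2)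
        (g := fun b : ((List ℕ × ℕ) × ℕ) × ℕ => (b.1.1.1, b.1.2)) hH.partrec_useValues
        ((Computable.fst.comp (Computable.fst.comp Computable.fst)).pair
          (Computable.snd.comp Computable.fst))
    have h3 : Partrec fun b : (((List ℕ × ℕ) × ℕ) × ℕ) × List ℕ =>
        oracleAnswer b.1.2 b.1.1.1.2 b.2 :=
      Partrec.comp (f := fun a : ℕ × ℕ × List ℕ => oracleAnswer a.1 a.2.1 a.2.2)
        (g := fun b : (((List ℕ × ℕ) × ℕ) × ℕ) × List ℕ => (b.1.2, b.1.1.1.2, b.2))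
        partrec_oracleAnswer ((Computable.snd.comp Computable.fst).pair
        ((Computable.snd.comp (Computable.fst.comp (Computable.fst.comp Computable.fst))).pair
          Computable.snd))
    exact h1.bind (h2.bind h3.to₂).to₂
  have hmono : ∀ {s t : List ℕ} {n k v : ℕ}, s <+: t → v ∈ A s n k → v ∈ A t n k := by
    intro s t n k v hst hv
    simp only [A, Part.mem_bind_iff] at hv ⊢
    obtain ⟨e, he, l, hl, hv⟩ := hv
    exact ⟨e, hE.mono hst he, l, hH.useValues_mono hst hl, hv⟩
  have hK : IsUseFunction fun a => firstPositive (A a.1 a.2) := by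
    refine ⟨?_, ?_⟩
    · have h0 : Computable fun v : ℕ => decide (v ≠ 0) :=
        (Primrec.not.comp (Primrec.eq.decide.comp Primrec.id (Primrec.const 0))).to_comp.of_eq
          fun v => by simp
      exact (Partrec.rfind (hA.map (h0.comp Computable.snd).to₂).to₂).bind
        (hA.map (Computable.pred.comp Computable.snd).to₂).to₂
    · intro s t n v hst hv
      rw [mem_firstPositive] at hv ⊢
      obtain ⟨k, hk, hj⟩ := hv
      exact ⟨k, hmono hst hk, fun j hjk => hmono hst (hj j hjk)⟩
  refine ⟨_, hK, fun e p q r he hq hr n => ?_⟩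
  have hn := mem_functional.1 hr n
  rw [oracleEval_eq, mem_firstPositive] at hn
  obtain ⟨k, hk, hj⟩ := hn
  have : ∀ᶠ m in atTop, ∀ j < k, q j ∈ H (p.initSeg m, j) :=
    (eventually_all_finite (Set.finite_lt_nat k)).2 fun j _ => hq j
  filter_upwards [this, he n] with m hm hem
  rw [mem_firstPositive]
  exact ⟨k, Part.mem_bind hem (Part.mem_bind (useValues_eq hm) hk), fun j hjk =>
    Part.mem_bind hem (Part.mem_bind (useValues_eq fun i hi => hm i (hi.trans hjk)) (hj j hjk))⟩

theorem id : IsUseFunction fun a => (a.1[a.2]? : Option ℕ) := oracle Computable.id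

theorem exists_of_functional (e : ℕ) :
    ∃ K, IsUseFunction K ∧ ∀ p r : Baire, r ∈ functional e p → ∀ n, UseComputes K p n (r n) := by
  obtain ⟨K, hK, h⟩ := (of_computable (Computable.const e)).exists_functional_comp id
  exact ⟨K, hK, fun p r => h e p p r (fun n => .of_forall fun _ => Part.mem_some _)
    fun n => useComputes_oracle _root_.id⟩

end IsUseFunction

namespace Baire

theorem TuringLE.exists_functional {p q : Baire} (h : TuringLE q p) :
    ∃ e, q ∈ functional e p := by
  -- Induction on the derivation of `g`. Only values that `g` really takes have to be reproduced, so
  -- divergence needs no bookkeeping. Each such value uses finitely many others, and finitely many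
  -- eventual statements hold simultaneously.
  have key : ∀ g : ℕ →. ℕ, Nat.RecursiveIn {(p : ℕ →. ℕ)} g →
      ∃ H, IsUseFunction H ∧ ∀ n v, v ∈ g n → UseComputes H p n v := by
    intro g hg
    induction hg with
    | zero =>
      exact ⟨_, .of_computable (Computable.const 0), fun n v hv => .of_forall fun _ => hv⟩
    | succ => exact ⟨_, .of_computable Computable.succ, fun n v hv => .of_forall fun _ => hv⟩
    | left =>
      exact ⟨_, .of_computable (Computable.fst.comp Computable.unpair),
        fun n v hv => .of_forall fun _ => hv⟩
    | right =>
      exact ⟨_, .of_computable (Computable.snd.comp Computable.unpair),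
        fun n v hv => .of_forall fun _ => hv⟩
    | oracle g hg =>
      rw [Set.mem_singleton_iff] at hg
      subst hg
      refine ⟨_, IsUseFunction.id, fun n v hv => ?_⟩
      obtain rfl : v = p n := Part.mem_some_iff.1 hv
      exact IsUseFunction.useComputes_oracle _root_.id
    | pair _ _ ihf ihg =>
      obtain ⟨H, hH, hH'⟩ := ihf
      obtain ⟨K, hK, hK'⟩ := ihg
      refine ⟨_, hH.pair hK, fun n v hv => ?_⟩
      simp only [Seq.seq, Part.map_eq_map, Part.mem_bind_iff, Part.mem_map_iff] at hv
      obtain ⟨_, ⟨x, hx, rfl⟩, y, hy, rfl⟩ := hv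
      filter_upwards [hH' _ _ hx, hK' _ _ hy] with k h1 h2
      simp only [Seq.seq, Part.map_eq_map, Part.mem_bind_iff, Part.mem_map_iff]
      exact ⟨_, ⟨x, h1, rfl⟩, y, h2, rfl⟩
    | comp _ _ ihf ihg =>
      obtain ⟨H, hH, hH'⟩ := ihf
      obtain ⟨K, hK, hK'⟩ := ihg
      refine ⟨_, hH.comp hK, fun n v hv => ?_⟩
      obtain ⟨x, hx, hv⟩ := Part.mem_bind_iff.1 hv
      filter_upwards [hK' _ _ hx, hH' _ _ hv] with k h1 h2
      exact Part.mem_bind h1 h2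
    | prec _ _ ihf ihg =>
      obtain ⟨H, hH, hH'⟩ := ihf
      obtain ⟨K, hK, hK'⟩ := ihg
      refine ⟨_, hH.prec hK, fun n v => ?_⟩
      unfold UseComputes
      dsimp only
      generalize n.unpair.2 = m
      induction m generalizing v with
      | zero => exact hH' _ _
      | succ m ih =>
        intro hv
        obtain ⟨x, hx, hv⟩ := Part.mem_bind_iff.1 hv
        filter_upwards [ih _ hx, hK' _ _ hv] with k h1 h2
        exact Part.mem_bind h1 h2
    | rfind _ ih =>
      obtain ⟨H, hH, hH'⟩ := ih
      refine ⟨_, hH.rfind, fun n v hv => ?_⟩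
      simp only [mem_rfind_iff, Part.map_eq_map, Part.mem_map_iff] at hv
      obtain ⟨⟨x, hx, hx0⟩, hv⟩ := hv
      have : ∀ᶠ k in atTop, ∀ m < v, ∃ a ∈ H (p.initSeg k, Nat.pair n m),
          decide (a = 0) = false := by
        refine (eventually_all_finite (Set.finite_lt_nat v)).2 fun m hm => ?_
        obtain ⟨y, hy, hy0⟩ := hv m hm
        filter_upwards [hH' _ _ hy] with k hk using ⟨y, hk, hy0⟩
      filter_upwards [hH' _ _ hx, this] with k h1 h2
      simp only [mem_rfind_iff, Part.map_eq_map, Part.mem_map_iff]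
      exact ⟨⟨x, h1, hx0⟩, h2⟩
  obtain ⟨H, hH, hH'⟩ := key _ (RecursiveIn.iff_nat.1 h)
  obtain ⟨e, he⟩ := hH.exists_functional
  exact ⟨e, he p q fun n => hH' n (q n) (Part.mem_some _)⟩

/-- The search defining `oracleEval` is rebuilt from the closure operations of `Nat.RecursiveIn`;
the oracle enters through the codes of its initial segments. -/
theorem TuringLE.of_functional {e : ℕ} {p q : Baire} (h : q ∈ functional e p) :
    TuringLE q p := by
  set O : Set (ℕ →. ℕ) := {(p : ℕ →. ℕ)}
  have hpair : ∀ {f g : ℕ → ℕ}, Nat.RecursiveIn O (f : ℕ →. ℕ) → Nat.RecursiveIn O (g : ℕ →. ℕ) →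
      Nat.RecursiveIn O ((fun n => Nat.pair (f n) (g n) : ℕ → ℕ) : ℕ →. ℕ) := fun hf hg =>
    (hf.pair hg).of_eq fun n => by simp [Seq.seq]
  have hcomp : ∀ {f : ℕ →. ℕ} {g : ℕ → ℕ}, Nat.RecursiveIn O f → Nat.RecursiveIn O (g : ℕ →. ℕ) →
      Nat.RecursiveIn O fun n => f (g n) := fun hf hg =>
    (hf.comp hg).of_eq fun n => Part.bind_some _ _
  have hcomp' : ∀ {f g : ℕ → ℕ}, Nat.RecursiveIn O (f : ℕ →. ℕ) → Nat.RecursiveIn O (g : ℕ →. ℕ) →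
      Nat.RecursiveIn O ((fun n => f (g n) : ℕ → ℕ) : ℕ →. ℕ) := fun {f _} hf hg =>
    hcomp (f := (f : ℕ →. ℕ)) hf hg
  have hcomputable : ∀ {f : ℕ → ℕ}, Computable f → Nat.RecursiveIn O (f : ℕ →. ℕ) := fun hf =>
    (Partrec.nat_iff.1 hf.partrec).recursiveIn
  have hfst : Nat.RecursiveIn O ((fun n => n.unpair.1 : ℕ → ℕ) : ℕ →. ℕ) :=
    hcomputable (Computable.fst.comp Computable.unpair)
  have hsnd : Nat.RecursiveIn O ((fun n => n.unpair.2 : ℕ → ℕ) : ℕ →. ℕ) :=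
    hcomputable (Computable.snd.comp Computable.unpair)
  have hp : Nat.RecursiveIn O (p : ℕ →. ℕ) := .oracle _ rfl
  have happend : Computable fun n : ℕ =>
      encode ((decode (α := List ℕ) n.unpair.1).getD [] ++ [n.unpair.2]) :=
    Computable.encode.comp (Computable.list_concat.comp (Computable.option_getD
      (Computable.decode.comp (Computable.fst.comp Computable.unpair)) (Computable.const []))
      (Computable.snd.comp Computable.unpair))
  have hinit : Nat.RecursiveIn O ((fun k => encode (p.initSeg k) : ℕ → ℕ) : ℕ →. ℕ) := by
    -- Primitive recursion with a dummy parameter, later set to `0`: the step appends `p y` to the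
    -- coded list of the preceding values.
    have h1 := (hcomputable (Computable.const (encode ([] : List ℕ)))).prec (hcomp
      (hcomputable happend) (hpair (hcomp' hsnd hsnd) (hcomp' hp (hcomp' hfst hsnd))))
    refine (hcomp h1 (hpair (hcomputable (Computable.const 0)) (hcomputable Computable.id))).of_eq
      fun k => ?_
    simp only [Nat.unpair_pair, _root_.id]
    induction k with
    | zero => rfl
    | succ k ih =>
      dsimp only
      rw [ih]
      simp [p.initSeg_succ]
  have hans : Nat.RecursiveIn O fun m => oracleAnswer e m.unpair.1 (p.initSeg m.unpair.2) := by
    have h1 : Nat.RecursiveIn O (Denumerable.ofNat Nat.Partrec.Code e).eval :=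
      (Nat.Partrec.Code.exists_code.2 ⟨_, rfl⟩).recursiveIn
    exact (hcomp h1 (hpair hfst (hcomp' hinit hsnd))).of_eq fun m => rfl
  -- `rfind` looks for a zero, whereas the search stops at a nonzero answer; truncated subtraction
  -- exchanges the two.
  have hflip : Computable fun v : ℕ => 1 - v :=
    (Primrec.nat_sub.comp (Primrec.const 1) Primrec.id).to_comp
  have hfind := ((hcomputable hflip).comp hans).rfind
  refine RecursiveIn.iff_nat.2 <| ((hcomputable Computable.pred).comp (hans.comp
    ((hcomputable Computable.id).pair hfind))).of_eq_tot fun n => ?_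
  have hn := mem_functional.1 h n
  rw [oracleEval_eq, mem_firstPositive] at hn
  obtain ⟨k, hk, hj⟩ := hn
  refine Part.mem_bind (a := q n + 1) (Part.mem_bind (a := Nat.pair n k) ?_ ?_) (Part.mem_some _)
  · simp only [Seq.seq, Part.map_eq_map, Part.mem_bind_iff, Part.mem_map_iff]
    refine ⟨_, ⟨n, Part.mem_some _, rfl⟩, k, ?_, rfl⟩
    simp only [mem_rfind_iff, Part.mem_map_iff]
    refine ⟨⟨0, Part.mem_bind (a := q n + 1) (by simpa using hk) ?_, by simp⟩, fun m hm =>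
      ⟨1, Part.mem_bind (a := 0) (by simpa using hj m hm) ?_, by simp⟩⟩
    · simp [PFun.lift]
    · simp [PFun.lift]
  · simpa using hk

end Baire

end

/-! ### A calculus of functions computable on a set of points. -/

section

open Filter Set

namespace Baire

/-- The first component of a pair of points. -/
def fst (z : Baire) : Baire := fun n => z (2 * n)

/-- The second component of a pair of points. -/
def snd (z : Baire) : Baire := fun n => z (2 * n + 1)

/-- The sequence without its first term. -/
def tail (z : Baire) : Baire := fun n => z (n + 1)

@[simp]
theorem fst_pair (p q : Baire) : (pair p q).fst = p := by
  funext n; simp [fst, pair]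

@[simp]
theorem snd_pair (p q : Baire) : (pair p q).snd = q := by
  funext n
  have : (2 * n + 1) / 2 = n := by omega
  simp [snd, pair, this]

@[simp]
theorem pair_fst_snd (z : Baire) : pair z.fst z.snd = z := by
  funext n
  rcases Nat.mod_two_eq_zero_or_one n with h | h
  · simp only [pair, fst, h, if_true]; congr 1; omega
  · simp only [pair, snd, h]; simp only [one_ne_zero, if_false]; congr 1; omega

@[simp]
theorem pair_zero (p q : Baire) : pair p q 0 = p 0 := rfl

@[simp]
theorem tail_cons (m : ℕ) (p : Baire) : (cons m p).tail = p := rfl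

@[simp]
theorem cons_zero (m : ℕ) (p : Baire) : cons m p 0 = m := rfl

end Baire

open Baire

/-- On the set `A`, the function `F` agrees with a computable functional. -/
def ComputableOn (A : Set Baire) (F : Baire → Baire) : Prop :=
  ∃ e, ∀ p ∈ A, F p ∈ functional e p

namespace ComputableOn

variable {A B : Set Baire} {F G : Baire → Baire}

theorem mono (hF : ComputableOn B F) (h : A ⊆ B) : ComputableOn A F :=
  hF.imp fun _ he p hp => he p (h hp)

theorem congr (hF : ComputableOn A F) (h : ∀ p ∈ A, F p = G p) : ComputableOn A G :=
  hF.imp fun _ he p hp => h p hp ▸ he p hp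

theorem of_use {H : List ℕ × ℕ →. ℕ} (hH : IsUseFunction H)
    (h : ∀ p ∈ A, ∀ n, UseComputes H p n (F p n)) : ComputableOn A F :=
  hH.exists_functional.imp fun _ he p hp => he p _ (h p hp)

theorem exists_use (hF : ComputableOn A F) :
    ∃ H, IsUseFunction H ∧ ∀ p ∈ A, ∀ n, UseComputes H p n (F p n) := by
  obtain ⟨e, he⟩ := hF
  obtain ⟨H, hH, h⟩ := IsUseFunction.exists_of_functional e
  exact ⟨H, hH, fun p hp => h p _ (he p hp)⟩

theorem comp (hG : ComputableOn B G) (hF : ComputableOn A F) (h : MapsTo F A B) :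
    ComputableOn A fun p => G (F p) := by
  obtain ⟨H, hH, hF⟩ := hF.exists_use
  obtain ⟨e, he⟩ := hG
  obtain ⟨K, hK, hKe⟩ :=
    (IsUseFunction.of_computable (Computable.const e)).exists_functional_comp hH
  exact of_use hK fun p hp => hKe e p _ _ (fun _ => .of_forall fun _ => Part.mem_some _)
    (hF p hp) (he _ (h hp))

theorem reindex {f : ℕ → ℕ} (hf : Computable f) : ComputableOn A fun p n => p (f n) :=
  of_use (.oracle hf) fun _ _ _ => IsUseFunction.useComputes_oracle f

protected theorem id : ComputableOn A fun p => p := reindex Computable.id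

theorem fst : ComputableOn A Baire.fst :=
  reindex (Primrec.nat_mul.comp (Primrec.const 2) Primrec.id).to_comp

theorem snd : ComputableOn A Baire.snd :=
  reindex (Primrec.succ.comp (Primrec.nat_mul.comp (Primrec.const 2) Primrec.id)).to_comp

theorem tail : ComputableOn A Baire.tail := reindex Computable.succ

theorem const (m : ℕ) : ComputableOn A fun _ => Baire.const m :=
  of_use (.of_computable (Computable.const m)) fun _ _ _ => .of_forall fun _ => Part.mem_some _

theorem pair (hF : ComputableOn A F) (hG : ComputableOn A G) :
    ComputableOn A fun p => Baire.pair (F p) (G p) := by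
  obtain ⟨H, hH, hF⟩ := hF.exists_use
  obtain ⟨K, hK, hG⟩ := hG.exists_use
  have hhalf : Computable fun a : List ℕ × ℕ => (a.1, a.2 / 2) :=
    Computable.fst.pair
      (Primrec.nat_div.to_comp.comp Computable.snd (Computable.const 2))
  have hparity : Computable fun a : List ℕ × ℕ => decide (a.2 % 2 = 0) :=
    Primrec.eq.decide.to_comp.comp
      (Primrec.nat_mod.to_comp.comp Computable.snd (Computable.const 2)) (Computable.const 0)
  have hU : IsUseFunction fun a =>
      bif decide (a.2 % 2 = 0) then H (a.1, a.2 / 2) else K (a.1, a.2 / 2) := by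
    refine ⟨Partrec.cond hparity (hH.partrec.comp hhalf) (hK.partrec.comp hhalf), ?_⟩
    intro s t n v hst
    rcases Nat.mod_two_eq_zero_or_one n with h | h
    · simpa [h] using hH.mono hst
    · simpa [h] using hK.mono hst
  refine of_use hU fun p hp n => ?_
  rcases Nat.mod_two_eq_zero_or_one n with h | h
  · filter_upwards [hF p hp (n / 2)] with k hk
    simpa [h, Baire.pair] using hk
  · filter_upwards [hG p hp (n / 2)] with k hk
    simpa [h, Baire.pair] using hk

theorem cons (m : ℕ) : ComputableOn A (Baire.cons m) := by
  have hzero : Computable fun a : List ℕ × ℕ => decide (a.2 = 0) :=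
    Primrec.eq.decide.to_comp.comp Computable.snd (Computable.const 0)
  have hpred := IsUseFunction.oracle Computable.pred
  have hU : IsUseFunction fun a =>
      bif decide (a.2 = 0) then Part.some m else ((a.1[a.2.pred]? : Option ℕ) : Part ℕ) := by
    refine ⟨Partrec.cond hzero (Computable.const m).partrec hpred.partrec, ?_⟩
    intro s t n v hst
    rcases n with _ | n
    · exact fun h => h
    · exact hpred.mono (n := n + 1) hst
  refine of_use hU fun p _ n => ?_
  rcases n with _ | n
  · exact .of_forall fun _ => Part.mem_some _
  · exact IsUseFunction.useComputes_oracle (p := p) (n := n + 1) Nat.pred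

theorem ite_head {m : ℕ} (hF : ComputableOn {p ∈ A | p 0 = m} F)
    (hG : ComputableOn {p ∈ A | p 0 ≠ m} G) :
    ComputableOn A fun p => if p 0 = m then F p else G p := by
  obtain ⟨H, hH, hF⟩ := hF.exists_use
  obtain ⟨K, hK, hG⟩ := hG.exists_use
  have h0 := IsUseFunction.oracle (Computable.const 0)
  have hU : IsUseFunction fun a => ((a.1[0]? : Option ℕ) : Part ℕ).bind fun v =>
      bif decide (v = m) then H a else K a := by
    refine ⟨h0.partrec.bind (Partrec.cond
      (Primrec.eq.decide.to_comp.comp Computable.snd (Computable.const m))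
      (hH.partrec.comp Computable.fst) (hK.partrec.comp Computable.fst)).to₂, ?_⟩
    intro s t n v hst hv
    obtain ⟨w, hw, hv⟩ := Part.mem_bind_iff.1 hv
    refine Part.mem_bind (h0.mono (n := n) hst hw) ?_
    by_cases h : w = m
    · simp only [h, decide_true, cond_true] at hv ⊢
      exact hH.mono hst hv
    · simp only [h, decide_false, cond_false] at hv ⊢
      exact hK.mono hst hv
  refine of_use hU fun p hp n => ?_
  have hp0 := IsUseFunction.useComputes_oracle (p := p) (n := n) fun _ => 0
  by_cases h : p 0 = m
  · filter_upwards [hp0, hF p ⟨hp, h⟩ n] with k h1 h2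
    exact Part.mem_bind h1 (by simpa [h] using h2)
  · filter_upwards [hp0, hG p ⟨hp, h⟩ n] with k h1 h2
    exact Part.mem_bind h1 (by simpa [h] using h2)

theorem ite {m : ℕ} {C : Baire → Baire} (hC : ComputableOn A C)
    (hF : ComputableOn {p ∈ A | C p 0 = m} F) (hG : ComputableOn {p ∈ A | C p 0 ≠ m} G) :
    ComputableOn A fun p => if C p 0 = m then F p else G p := by
  -- Pairing `C p` with `p` moves the tested number to the first entry, where `ite_head` applies.
  have key : ComputableOn {z | z.snd ∈ A ∧ z 0 = C z.snd 0}
      fun z => if z 0 = m then F z.snd else G z.snd := by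
    refine ite_head (hF.comp snd fun z hz => ?_) (hG.comp snd fun z hz => ?_)
    · exact ⟨hz.1.1, hz.1.2 ▸ hz.2⟩
    · exact ⟨hz.1.1, hz.1.2 ▸ hz.2⟩
  exact (key.comp (hC.pair .id) fun p hp => by simpa using hp).congr fun p _ => by simp

theorem exists_of_forall {e : ℕ} {P : Baire → Baire → Prop}
    (h : ∀ p ∈ A, ∃ r ∈ functional e p, P p r) :
    ∃ F, ComputableOn A F ∧ ∀ p ∈ A, P p (F p) := by
  choose! F hF using h
  exact ⟨F, ⟨e, fun p hp => (hF p hp).1⟩, fun p hp => (hF p hp).2⟩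

end ComputableOn

theorem medvedevLE_iff {A B : Set Baire} :
    MedvedevLE A B ↔ ∃ F, ComputableOn B F ∧ MapsTo F B A :=
  ⟨fun ⟨_, he⟩ => ComputableOn.exists_of_forall he,
    fun ⟨F, ⟨e, he⟩, hF⟩ => ⟨e, fun b hb => ⟨F b, he b hb, hF hb⟩⟩⟩

/-- The universal functional `e ⌢ q ↦ Φ_e(q)`. -/
theorem exists_universal_functional :
    ∃ u, ∀ (e : ℕ) (p q : Baire), p ∈ functional e q → p ∈ functional u (cons e q) := by
  obtain ⟨K, hK, h⟩ := (IsUseFunction.oracle (Computable.const 0)).exists_functional_comp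
    (.oracle Computable.succ)
  obtain ⟨u, hu⟩ := hK.exists_functional
  exact ⟨u, fun e p q hp => hu _ _ (h e _ q p
    (fun _ => IsUseFunction.useComputes_oracle (p := cons e q) fun _ => 0)
    (fun _ => IsUseFunction.useComputes_oracle (p := cons e q) Nat.succ) hp)⟩

theorem ComputableOn.medvedevLE {A B : Set Baire} {F : Baire → Baire} (hF : ComputableOn B F)
    (h : MapsTo F B A) : MedvedevLE A B :=
  medvedevLE_iff.2 ⟨F, hF, h⟩

/-! ### Basic properties of Weihrauch reducibility and joins. -/

namespace Problem

variable {f g h k : Problem}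

/-- The codes of the pairs of an instance `p` of `f` and a solution of the instance `Φ p` of `g`. -/
def answers (f g : Problem) (Φ : Baire → Baire) : Set Baire :=
  {z | z.fst ∈ f.dom ∧ z.snd ∈ g (Φ z.fst)}

theorem weihrauchLE_iff : f.WeihrauchLE g ↔ ∃ Φ Ψ : Baire → Baire,
    ComputableOn f.dom Φ ∧ ComputableOn (answers f g Φ) Ψ ∧
      ∀ p ∈ f.dom, Φ p ∈ g.dom ∧ ∀ q ∈ g (Φ p), Ψ (pair p q) ∈ f p := by
  constructor
  · rintro ⟨d, e, hde⟩
    obtain ⟨Φ, hΦ, hΦ'⟩ := ComputableOn.exists_of_forall hde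
    have : ∀ z ∈ answers f g Φ, ∃ y ∈ functional e z, y ∈ f z.fst := fun z hz => by
      simpa using (hΦ' _ hz.1).2 _ hz.2
    obtain ⟨Ψ, hΨ, hΨ'⟩ := ComputableOn.exists_of_forall this
    refine ⟨Φ, Ψ, hΦ, hΨ, fun p hp => ⟨(hΦ' p hp).1, fun q hq => ?_⟩⟩
    simpa using hΨ' (pair p q) ⟨by simpa using hp, by simpa using hq⟩
  · rintro ⟨Φ, Ψ, ⟨d, hd⟩, ⟨e, he⟩, H⟩
    exact ⟨d, e, fun p hp => ⟨Φ p, hd p hp, (H p hp).1, fun q hq =>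
      ⟨_, he _ ⟨by simpa using hp, by simpa using hq⟩, (H p hp).2 q hq⟩⟩⟩

theorem WeihrauchLE.intro (Φ Ψ : Baire → Baire) (hΦ : ComputableOn f.dom Φ)
    (hΨ : ComputableOn (answers f g Φ) Ψ) (hdom : MapsTo Φ f.dom g.dom)
    (H : ∀ p ∈ f.dom, ∀ q ∈ g (Φ p), Ψ (pair p q) ∈ f p) : f.WeihrauchLE g :=
  weihrauchLE_iff.2 ⟨Φ, Ψ, hΦ, hΨ, fun p hp => ⟨hdom hp, H p hp⟩⟩

theorem mapsTo_fst_answers {Φ : Baire → Baire} : MapsTo Baire.fst (answers f g Φ) f.dom :=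
  fun _ hz => hz.1

theorem WeihrauchLE.refl (f : Problem) : f.WeihrauchLE f :=
  .intro _ _ .id .snd (fun _ hp => hp) fun _ _ q hq => by simpa using hq

theorem WeihrauchLE.trans (hfg : f.WeihrauchLE g) (hgh : g.WeihrauchLE h) : f.WeihrauchLE h := by
  obtain ⟨Φ, Ψ, hΦ, hΨ, H⟩ := weihrauchLE_iff.1 hfg
  obtain ⟨Φ', Ψ', hΦ', hΨ', H'⟩ := weihrauchLE_iff.1 hgh
  refine .intro (fun p => Φ' (Φ p)) (fun z => Ψ (pair z.fst (Ψ' (pair (Φ z.fst) z.snd))))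
    (hΦ'.comp hΦ fun p hp => (H p hp).1) ?_ (fun p hp => (H' _ (H p hp).1).1) ?_
  · refine hΨ.comp (.pair .fst (hΨ'.comp (.pair (hΦ.comp .fst mapsTo_fst_answers) .snd) ?_)) ?_
    · intro z hz
      exact ⟨by simpa using (H _ hz.1).1, by simpa using hz.2⟩
    · intro z hz
      exact ⟨by simpa using hz.1, by simpa using (H' _ (H _ hz.1).1).2 _ hz.2⟩
  · intro p hp q hq
    simpa using (H p hp).2 _ ((H' _ (H p hp).1).2 q hq)

theorem WeihrauchLE.medvedevLE (hfg : f.WeihrauchLE g) : MedvedevLE g.dom f.dom := by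
  obtain ⟨Φ, Ψ, hΦ, hΨ, H⟩ := weihrauchLE_iff.1 hfg
  exact hΦ.medvedevLE fun p hp => (H p hp).1

@[simp]
theorem dom_idRestrict (A : Set Baire) : (idRestrict A).dom = A :=
  Set.ext fun p => ⟨fun ⟨_, hq⟩ => hq.1, fun hp => ⟨p, hp, rfl⟩⟩

/-- A solution of `id|A` is the instance itself, so the backward functional can ignore the answer of
`g`; only finding an instance of `g` matters. -/
theorem idRestrict_weihrauchLE_iff {A : Set Baire} :
    (idRestrict A).WeihrauchLE g ↔ MedvedevLE g.dom A := by
  refine ⟨fun h => by simpa using h.medvedevLE, fun h => ?_⟩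
  obtain ⟨F, hF, hFA⟩ := medvedevLE_iff.1 h
  refine .intro F Baire.fst (by simpa using hF) .fst (by simpa using hFA) fun p hp q _ => ?_
  exact ⟨by simpa using hp, by simp⟩

@[simp]
theorem join_pair_zero (x : Baire) : f.join g (pair (const 0) x) = f x := by
  ext y
  constructor
  · rintro (⟨x', h, hy⟩ | ⟨x', h, hy⟩)
    · rwa [← snd_pair (const 0) x, h, snd_pair]
    · simpa [const] using congrFun h 0
  · exact fun hy => .inl ⟨x, rfl, hy⟩

@[simp]
theorem join_pair_one (x : Baire) : f.join g (pair (const 1) x) = g x := by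
  ext y
  constructor
  · rintro (⟨x', h, hy⟩ | ⟨x', h, hy⟩)
    · simpa [const] using congrFun h 0
    · rwa [← snd_pair (const 1) x, h, snd_pair]
  · exact fun hy => .inr ⟨x, rfl, hy⟩

theorem mem_dom_join {z : Baire} : z ∈ (f.join g).dom ↔
    (∃ x ∈ f.dom, z = pair (const 0) x) ∨ ∃ x ∈ g.dom, z = pair (const 1) x := by
  constructor
  · rintro ⟨y, ⟨x, hz, hy⟩ | ⟨x, hz, hy⟩⟩
    · exact .inl ⟨x, ⟨y, hy⟩, hz⟩
    · exact .inr ⟨x, ⟨y, hy⟩, hz⟩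
  · rintro (⟨x, ⟨y, hy⟩, rfl⟩ | ⟨x, ⟨y, hy⟩, rfl⟩)
    · exact ⟨y, by simpa using hy⟩
    · exact ⟨y, by simpa using hy⟩

theorem left_weihrauchLE_join : f.WeihrauchLE (f.join g) :=
  .intro (fun p => pair (const 0) p) Baire.snd (.pair (.const 0) .id) .snd
    (fun p hp => mem_dom_join.2 (.inl ⟨p, hp, rfl⟩)) fun p _ q hq => by simpa using hq

theorem right_weihrauchLE_join : g.WeihrauchLE (f.join g) :=
  .intro (fun p => pair (const 1) p) Baire.snd (.pair (.const 1) .id) .snd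
    (fun p hp => mem_dom_join.2 (.inr ⟨p, hp, rfl⟩)) fun p _ q hq => by simpa using hq

theorem join_weihrauchLE (hf : f.WeihrauchLE k) (hg : g.WeihrauchLE k) :
    (f.join g).WeihrauchLE k := by
  obtain ⟨Φ, Ψ, hΦ, hΨ, H⟩ := weihrauchLE_iff.1 hf
  obtain ⟨Φ', Ψ', hΦ', hΨ', H'⟩ := weihrauchLE_iff.1 hg
  have hzero : ∀ {z}, z ∈ (f.join g).dom → z 0 = 0 → ∃ x ∈ f.dom, z = pair (const 0) x := by
    intro z hz hz0
    rcases mem_dom_join.1 hz with h | ⟨x, hx, rfl⟩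
    · exact h
    · simp [const] at hz0
  have hone : ∀ {z}, z ∈ (f.join g).dom → z 0 ≠ 0 → ∃ x ∈ g.dom, z = pair (const 1) x := by
    intro z hz hz0
    rcases mem_dom_join.1 hz with ⟨x, hx, rfl⟩ | h
    · simp [const] at hz0
    · exact h
  refine .intro (fun z => if z 0 = 0 then Φ z.snd else Φ' z.snd)
    (fun w => if w.fst 0 = 0 then Ψ (pair w.fst.snd w.snd) else Ψ' (pair w.fst.snd w.snd))
    (.ite .id (hΦ.comp .snd ?_) (hΦ'.comp .snd ?_))
    (.ite .fst
      (hΨ.comp (.pair (ComputableOn.snd.comp .fst (mapsTo_univ _ _)) .snd) ?_)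
      (hΨ'.comp (.pair (ComputableOn.snd.comp .fst (mapsTo_univ _ _)) .snd) ?_)) ?_ ?_
  · rintro z ⟨hz, hz0⟩
    obtain ⟨x, hx, rfl⟩ := hzero hz hz0
    simpa using hx
  · rintro z ⟨hz, hz0⟩
    obtain ⟨x, hx, rfl⟩ := hone hz hz0
    simpa using hx
  · rintro w ⟨⟨hz, hw⟩, hz0⟩
    obtain ⟨x, hx, hzx⟩ := hzero hz hz0
    simp only [hz0, if_true, hzx, snd_pair] at hw
    exact ⟨by simpa [hzx] using hx, by simpa [hzx, const] using hw⟩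
  · rintro w ⟨⟨hz, hw⟩, hz0⟩
    obtain ⟨x, hx, hzx⟩ := hone hz hz0
    exact ⟨by simpa [hzx] using hx, by simpa [hzx, const] using hw⟩
  · intro z hz
    rcases mem_dom_join.1 hz with ⟨x, hx, rfl⟩ | ⟨x, hx, rfl⟩
    · simpa [const] using (H x hx).1
    · simpa [const] using (H' x hx).1
  · intro z hz q hq
    rcases mem_dom_join.1 hz with ⟨x, hx, rfl⟩ | ⟨x, hx, rfl⟩
    · simpa [const] using (H x hx).2 q (by simpa [const] using hq)
    · simpa [const] using (H' x hx).2 q (by simpa [const] using hq)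

end Problem

end

/-! ### Condition 2 gives a minimal cover. -/

section

open Set Baire

namespace Problem

variable {f g h : Problem}

/-- If the reduction sends `x` to the summand `id|{p}`, then `x` computes `p` by a fixed index `e`,
so `e ⌢ x` lies in `p⁺` and gives an instance of `h`. Its answer is discarded, since the solution
`p` is computable from `x`. The first entry of `Φ x` decides which case holds. -/
theorem WeihrauchLE.join_idRestrict_of_medvedevSucc {p : Baire}
    (hg : g.WeihrauchLE (h.join (idRestrict {p}))) (hp : ∀ x ∈ g.dom, ¬ TuringLE x p)
    (hsucc : MedvedevLE h.dom (medvedevSucc p)) : g.WeihrauchLE h := by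
  obtain ⟨Φ, Ψ, hΦ, hΨ, H⟩ := weihrauchLE_iff.1 hg
  obtain ⟨K, hK, hKdom⟩ := medvedevLE_iff.1 hsucc
  have hsnd : ComputableOn g.dom fun x => (Φ x).snd :=
    ComputableOn.snd.comp hΦ (mapsTo_univ _ _)
  obtain ⟨e, he⟩ := hsnd
  have hzero : ∀ x ∈ g.dom, Φ x 0 = 0 → ∃ y ∈ h.dom, Φ x = pair (const 0) y := by
    intro x hx hx0
    rcases mem_dom_join.1 (H x hx).1 with h | ⟨y, hy, hxy⟩
    · exact h
    · simp [hxy, const] at hx0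
  have hone : ∀ x ∈ g.dom, Φ x 0 ≠ 0 → Φ x = pair (const 1) p ∧ cons e x ∈ medvedevSucc p := by
    intro x hx hx0
    rcases mem_dom_join.1 (H x hx).1 with ⟨y, hy, hxy⟩ | ⟨y, hy, hxy⟩
    · simp [hxy, const] at hx0
    · obtain rfl : y = p := by simpa using hy
      exact ⟨hxy, e, x, rfl, by simpa [hxy] using he x hx, hp x hx⟩
  have hKcons : ComputableOn {x ∈ g.dom | Φ x 0 ≠ 0} fun x => K (cons e x) :=
    hK.comp (.cons e) fun x hx => (hone x hx.1 hx.2).2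
  set Φ' : Baire → Baire := fun x => if Φ x 0 = 0 then (Φ x).snd else K (cons e x) with hΦ'
  refine .intro Φ' (fun w => if Φ w.fst 0 = 0 then Ψ w else Ψ (pair w.fst (Φ w.fst).snd))
    (.ite hΦ ⟨e, fun x hx => he x hx.1⟩ hKcons) (.ite (hΦ.comp .fst mapsTo_fst_answers) ?_ ?_) ?_ ?_
  · refine hΨ.mono ?_
    rintro w ⟨⟨hw, hwq⟩, hw0⟩
    obtain ⟨y, hy, hxy⟩ := hzero _ hw hw0
    refine ⟨hw, ?_⟩
    simp only [hΦ', hw0, if_true] at hwq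
    simpa [hxy] using hwq
  · refine hΨ.comp (.pair .fst (ComputableOn.comp (B := g.dom) (G := fun x => (Φ x).snd) ⟨e, he⟩
      .fst fun w hw => hw.1.1)) ?_
    rintro w ⟨⟨hw, hwq⟩, hw0⟩
    refine ⟨by simpa using hw, ?_⟩
    simp only [fst_pair, snd_pair, (hone _ hw hw0).1, join_pair_one]
    exact ⟨rfl, rfl⟩
  · intro x hx
    by_cases hx0 : Φ x 0 = 0
    · obtain ⟨y, hy, hxy⟩ := hzero x hx hx0
      simpa only [hΦ', hx0, if_true, hxy, snd_pair] using hy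
    · simpa only [hΦ', hx0, if_false] using hKdom (hone x hx hx0).2
  · intro x hx q hq
    by_cases hx0 : Φ x 0 = 0
    · obtain ⟨y, hy, hxy⟩ := hzero x hx hx0
      simp only [hΦ', hx0, if_true] at hq
      simp only [fst_pair, hx0, if_true]
      exact (H x hx).2 q (by simpa [hxy] using hq)
    · simp only [fst_pair, hx0, if_false]
      refine (H x hx).2 _ ?_
      simp only [(hone _ hx hx0).1, join_pair_one, snd_pair]
      exact ⟨rfl, rfl⟩

theorem isMinimalCover_of_weihrauchEquiv {p : Baire}
    (hf : f.WeihrauchEquiv (h.join (idRestrict {p}))) (hp : ¬ MedvedevLE h.dom {p})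
    (hsucc : MedvedevLE h.dom (medvedevSucc p)) : f.IsMinimalCover h := by
  refine ⟨⟨left_weihrauchLE_join.trans hf.2, fun hfh => hp ?_⟩, ?_⟩
  · exact idRestrict_weihrauchLE_iff.1 (right_weihrauchLE_join.trans (hf.2.trans hfh))
  · rintro ⟨g, ⟨hhg, hgh⟩, hgf, hfg⟩
    -- If `p` computes an instance of `g`, then `id|{p} ≤ g` and `g` is equivalent to `f`; if not,
    -- `g` falls down to `h`.
    by_cases hx : ∃ x ∈ g.dom, TuringLE x p
    · obtain ⟨x, hx, hxp⟩ := hx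
      obtain ⟨e, he⟩ := hxp.exists_functional
      refine hfg (hf.1.trans (join_weihrauchLE hhg (idRestrict_weihrauchLE_iff.2 ⟨e, ?_⟩)))
      rintro _ rfl
      exact ⟨x, he, hx⟩
    · push Not at hx
      exact hgh ((hgf.trans hf.1).join_idRestrict_of_medvedevSucc hx hsucc)

theorem IsMinimalCover.le_or_le_join (hf : f.IsMinimalCover h) (hg : g.WeihrauchLE f) :
    g.WeihrauchLE h ∨ f.WeihrauchLE (h.join g) := by
  by_contra! hcon
  refine hf.2 ⟨h.join g, ⟨left_weihrauchLE_join, fun hle => hcon.1 ?_⟩,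
    join_weihrauchLE hf.1.1 hg, hcon.2⟩
  exact right_weihrauchLE_join.trans hle

/-! ### Single instances, and reductions by given programs at one instance. -/

/-- The restriction of a problem to the single instance `x`. -/
def restrict (f : Problem) (x : Baire) : Problem := fun z => {y | z = x ∧ y ∈ f x}

theorem dom_restrict {x : Baire} (hx : x ∈ f.dom) : (f.restrict x).dom = {x} :=
  Set.ext fun _ => ⟨fun ⟨_, hy⟩ => hy.1, fun hz => hx.imp fun _ hy => ⟨hz, hy⟩⟩

theorem restrict_self (f : Problem) (x : Baire) : f.restrict x x = f x := by
  ext; simp [restrict]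

/-- Programs `d` and `e` reduce the instance `p` of `f` to `g`. -/
def ReducesAt (d e : ℕ) (f g : Problem) (p : Baire) : Prop :=
  ∃ r ∈ functional d p, r ∈ g.dom ∧ ∀ q ∈ g r, ∃ y ∈ functional e (pair p q), y ∈ f p

theorem ReducesAt.congr {d e : ℕ} {f f' g g' : Problem} {p : Baire} (h : ReducesAt d e f g p)
    (hf : f p = f' p) (hg : ∀ r ∈ functional d p, g r = g' r) : ReducesAt d e f' g' p := by
  obtain ⟨r, hr, hdom, H⟩ := h
  have hgr := hg r hr
  refine ⟨r, hr, ?_, ?_⟩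
  · change (g' r).Nonempty
    rw [← hgr]
    exact hdom
  · rw [← hgr, ← hf]
    exact H

theorem exists_not_reducesAt (hfg : ¬ f.WeihrauchLE g) (d e : ℕ) :
    ∃ p ∈ f.dom, ¬ ReducesAt d e f g p := by
  by_contra! hcon
  exact hfg ⟨d, e, hcon⟩

theorem restrict_weihrauchLE {x : Baire} {Ψ : Baire → Baire} {Φ : Baire → Baire}
    (hΦ : ComputableOn {x} Φ) (hdom : Φ x ∈ g.dom)
    (hΨ : ComputableOn {z | z.fst = x ∧ z.snd ∈ g (Φ x)} Ψ)
    (H : ∀ q ∈ g (Φ x), Ψ (pair x q) ∈ f x) : (f.restrict x).WeihrauchLE g := by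
  have hsub : (f.restrict x).dom ⊆ {x} := fun _ ⟨_, hy⟩ => hy.1
  refine .intro Φ Ψ (hΦ.mono hsub) (hΨ.mono ?_) ?_ ?_
  · rintro z ⟨hz, hz'⟩
    have := hsub hz
    exact ⟨this, by rwa [this] at hz'⟩
  · intro z hz
    rwa [hsub hz]
  · intro z hz q hq
    obtain rfl := hsub hz
    rw [restrict_self]
    exact H q hq

theorem restrict_weihrauchLE_self (f : Problem) (x : Baire) : (f.restrict x).WeihrauchLE f := by
  by_cases hx : x ∈ f.dom
  · exact restrict_weihrauchLE .id hx .snd fun q hq => by simpa using hq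
  · exact .intro _ _ .id .id (fun z ⟨y, hz, hy⟩ => (hx ⟨y, hy⟩).elim)
      fun z ⟨y, hz, hy⟩ => (hx ⟨y, hy⟩).elim

theorem mem_dom_of_not_restrict_weihrauchLE {x : Baire} (hx : ¬ (f.restrict x).WeihrauchLE h) :
    x ∈ f.dom := by
  by_contra hxf
  exact hx (.intro _ _ .id .id (fun z ⟨y, hz, hy⟩ => (hxf ⟨y, hy⟩).elim)
    fun z ⟨y, hz, hy⟩ => (hxf ⟨y, hy⟩).elim)

/-- A problem with a computable solution from `x` reduces to every problem with a computable
instance from `x`. -/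
theorem restrict_weihrauchLE_of_mem {x y : Baire} (hx : MedvedevLE h.dom {x})
    {e : ℕ} (he : y ∈ functional e x) (hy : y ∈ f x) : (f.restrict x).WeihrauchLE h := by
  obtain ⟨F, hF, hFdom⟩ := medvedevLE_iff.1 hx
  have hsol : ComputableOn {x} fun _ => y := ⟨e, by rintro _ rfl; exact he⟩
  exact restrict_weihrauchLE hF (hFdom rfl) (hsol.comp .fst fun z hz => hz.1) fun _ _ => hy

/-- The instances of `spoiled f x c` are the sequences `n ⌢ x`; the solutions of such an instance
are those of `x` together with the constant sequence `c n`. -/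
def spoiled (f : Problem) (x : Baire) (c : ℕ → ℕ) : Problem :=
  fun z => {y | z.tail = x ∧ (y ∈ f x ∨ y = const (c (z 0)))}

end Problem

end

/-! ### An instance not reducible to `h` determines the minimal cover. -/

section

open Set Baire

namespace Problem

variable {f g h : Problem}

theorem spoiled_weihrauchLE {x : Baire} (hx : x ∈ f.dom) (c : ℕ → ℕ) :
    (spoiled f x c).WeihrauchLE f := by
  have htail : ∀ z ∈ (spoiled f x c).dom, z.tail = x := fun z ⟨_, hy⟩ => hy.1
  refine .intro Baire.tail Baire.snd .tail .snd (fun z hz => ?_) fun z hz q hq => ?_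
  · rwa [htail z hz]
  · rw [htail z hz] at hq
    exact ⟨htail z hz, .inl (by simpa using hq)⟩

/-- The instance `n ⌢ x` is reserved for the `n`-th pair of programs, and `c n` is chosen to defeat
it. One of the values `0` and `1` must do: a pair that succeeds against both always outputs a true
solution of `x`, as no output equals both constants, and so reduces `f.restrict x` to `h`. -/
theorem exists_spoiled_not_reducesAt {x : Baire} (hx : ¬ (f.restrict x).WeihrauchLE h) :
    ∃ c : ℕ → ℕ, ∀ n, ¬ ReducesAt n.unpair.1 n.unpair.2 (spoiled f x c) h (cons n x) := by
  have key : ∀ n, ∃ c : ℕ, ¬ ∃ r ∈ functional n.unpair.1 (cons n x), r ∈ h.dom ∧ ∀ q ∈ h r,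
      ∃ y ∈ functional n.unpair.2 (pair (cons n x) q), y ∈ f x ∨ y = const c := by
    intro n
    by_contra! hcon
    obtain ⟨r, hr, hdom, H⟩ := hcon 0
    obtain ⟨r', hr', -, H'⟩ := hcon 1
    obtain rfl := Part.mem_unique hr hr'
    have hsol : ∀ w ∈ {w | ∃ q ∈ h r, w = pair (cons n x) q},
        ∃ y ∈ functional n.unpair.2 w, y ∈ f x := by
      rintro _ ⟨q, hq, rfl⟩
      obtain ⟨y, hy, hyf⟩ := H q hq
      obtain ⟨y', hy', hyf'⟩ := H' q hq
      obtain rfl := Part.mem_unique hy hy'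
      refine ⟨y, hy, hyf.resolve_right fun h0 => hyf'.elim (fun h1 => ?_) fun h1 => ?_⟩
      · exact (hx (restrict_weihrauchLE (Φ := fun _ => r) (Ψ := fun _ => y)
          (ComputableOn.comp (B := {cons n x}) (G := fun _ => r)
            ⟨n.unpair.1, by rintro _ rfl; exact hr⟩ (.cons n) fun _ hp => congrArg (cons n) hp)
          hdom ((ComputableOn.const 0).congr fun _ _ => h0.symm) fun _ _ => h1)).elim
      · simpa [const] using congrFun (h0.symm.trans h1) 0
    obtain ⟨Ψ, hΨ, hΨf⟩ := ComputableOn.exists_of_forall hsol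
    refine hx (restrict_weihrauchLE (Φ := fun _ => r) (Ψ := fun z => Ψ (pair (cons n z.fst) z.snd))
      (ComputableOn.comp (B := {cons n x}) (G := fun _ => r)
        ⟨n.unpair.1, by rintro _ rfl; exact hr⟩ (.cons n) fun _ hp => congrArg (cons n) hp) hdom
      (hΨ.comp (.pair ((ComputableOn.cons n).comp .fst (mapsTo_univ _ _)) .snd) ?_) ?_)
    · rintro z ⟨hz, hq⟩
      exact ⟨z.snd, hq, by dsimp only; rw [hz]⟩
    · intro q hq
      exact hΨf _ ⟨q, hq, by simp⟩
  choose c hc using key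
  refine ⟨c, fun n ⟨r, hr, hdom, H⟩ => hc n ⟨r, hr, hdom, fun q hq => ?_⟩⟩
  obtain ⟨y, hy, hyf⟩ := H q hq
  exact ⟨y, hy, hyf.2⟩

/-- If some instance `x` of a minimal cover of `h` does not reduce to `h`, then `x` computes no
instance of `h`. -/
theorem IsMinimalCover.not_medvedevLE (hf : f.IsMinimalCover h) {x : Baire}
    (hx : ¬ (f.restrict x).WeihrauchLE h) : ¬ MedvedevLE h.dom {x} := by
  intro hMx
  have hxf := mem_dom_of_not_restrict_weihrauchLE hx
  obtain ⟨c, hc⟩ := exists_spoiled_not_reducesAt hx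
  rcases hf.le_or_le_join (spoiled_weihrauchLE hxf c) with ⟨d, e, H⟩ | hle
  · refine hc (Nat.pair d e) ?_
    rw [Nat.unpair_pair]
    obtain ⟨y, hy⟩ := hxf
    exact H _ ⟨y, rfl, .inl hy⟩
  -- The single instance `x` is sent to one summand. In the first, `f.restrict x` would reduce to
  -- `h`. In the second, the constant solution of the spoiled instance gives a solution of `x`
  -- computable from `x`, which suffices because `x` is assumed to compute an instance of `h`.
  · obtain ⟨Φ, Ψ, hΦ, hΨ, H⟩ := weihrauchLE_iff.1 ((restrict_weihrauchLE_self f x).trans hle)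
    rw [dom_restrict hxf] at hΦ
    have hxr : x ∈ (f.restrict x).dom := by rw [dom_restrict hxf]; rfl
    obtain ⟨hdom, H⟩ := H x hxr
    rw [restrict_self] at H
    rcases mem_dom_join.1 hdom with ⟨r, hr, hΦx⟩ | ⟨r, ⟨y, hr⟩, hΦx⟩
    · rw [hΦx, join_pair_zero] at H
      refine hx (restrict_weihrauchLE (Φ := fun p => (Φ p).snd)
        (ComputableOn.snd.comp hΦ (mapsTo_univ _ _)) (by simpa [hΦx] using hr) (hΨ.mono ?_)
        fun q hq => H q (by simpa [hΦx] using hq))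
      rintro z ⟨hz, hq⟩
      refine ⟨hz ▸ hxr, ?_⟩
      rw [hz, hΦx, join_pair_zero]
      simpa [hΦx] using hq
    · rw [hΦx, join_pair_one] at H
      have hmem : const (c (r 0)) ∈ spoiled f x c r := ⟨hr.1, .inr rfl⟩
      have hcomp : ComputableOn {x} fun p => Ψ (pair p (const (c (r 0)))) := by
        refine hΨ.comp (.pair .id (.const _)) ?_
        rintro _ rfl
        exact ⟨by simpa using hxr, by simpa [hΦx] using hmem⟩
      obtain ⟨e, he⟩ := hcomp
      exact hx (restrict_weihrauchLE_of_mem hMx (he x rfl) (H _ hmem))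

theorem IsMinimalCover.exists_weihrauchEquiv_of_restrict (hf : f.IsMinimalCover h) {x : Baire}
    (hx : ¬ (f.restrict x).WeihrauchLE h) :
    f.WeihrauchEquiv (h.join (idRestrict {x})) ∧
      ¬ MedvedevLE h.dom {x} ∧ MedvedevLE h.dom (medvedevSucc x) := by
  have hMx := hf.not_medvedevLE hx
  have hxf := mem_dom_of_not_restrict_weihrauchLE hx
  have hid : (idRestrict {x}).WeihrauchLE f :=
    idRestrict_weihrauchLE_iff.2 (ComputableOn.id.medvedevLE (by rintro _ rfl; exact hxf))
  refine ⟨⟨(hf.le_or_le_join hid).resolve_left fun h => hMx (idRestrict_weihrauchLE_iff.1 h),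
    join_weihrauchLE hf.1.1 hid⟩, hMx, ?_⟩
  -- A point `e ⌢ q` of `x⁺` computes `x` uniformly, by the universal functional, and `x` is an
  -- instance of `f`.
  have hsucc : (idRestrict (medvedevSucc x)).WeihrauchLE f := by
    refine WeihrauchLE.trans (idRestrict_weihrauchLE_iff.2 ?_) hid
    rw [dom_idRestrict]
    obtain ⟨u, hu⟩ := exists_universal_functional
    refine ⟨u, ?_⟩
    rintro _ ⟨e, q, rfl, hq, -⟩
    exact ⟨x, hu e x q hq, rfl⟩
  rcases hf.le_or_le_join hsucc with hle | hle
  · exact idRestrict_weihrauchLE_iff.1 hle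
  · have hM := (hid.trans hle).medvedevLE
    simp only [dom_idRestrict] at hM
    obtain ⟨F, hF, hFdom⟩ := medvedevLE_iff.1 hM
    have hsndF : ComputableOn {x} fun p => (F p).snd := ComputableOn.snd.comp hF (mapsTo_univ _ _)
    -- From `f ≤ h ⊔ id|x⁺`, the point `x` would compute an instance of `h`, or some `e ⌢ q` in `x⁺`
    -- and hence `q`; both are excluded.
    rcases mem_dom_join.1 (hFdom rfl) with ⟨r, hr, hFx⟩ | ⟨r, hr, hFx⟩
    · exact (hMx (hsndF.medvedevLE (by rintro _ rfl; simpa [hFx] using hr))).elim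
    · rw [dom_idRestrict] at hr
      obtain ⟨e, q, rfl, -, hq⟩ := hr
      obtain ⟨d, hd⟩ := ComputableOn.tail.comp hsndF (mapsTo_univ _ _)
      refine (hq (TuringLE.of_functional (e := d) ?_)).elim
      simpa [hFx] using hd x rfl

end Problem

end

/-! ### Diagonalization: a minimal cover has an instance not reducible to `h`. -/

section

open Set Baire

namespace Problem

variable {f g h : Problem}

/-- The instances of `tagged f D` are the sequences `m ⌢ x` with `(m, x) ∈ D`; the solutions of such
an instance are those of the instance `x` of `f`. -/
def tagged (f : Problem) (D : Set (ℕ × Baire)) : Problem :=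
  fun z => {y | (z 0, z.tail) ∈ D ∧ y ∈ f z.tail}

theorem mem_dom_tagged {D : Set (ℕ × Baire)} {z : Baire} :
    z ∈ (tagged f D).dom ↔ (z 0, z.tail) ∈ D ∧ z.tail ∈ f.dom :=
  ⟨fun ⟨y, hz, hy⟩ => ⟨hz, y, hy⟩, fun ⟨hz, y, hy⟩ => ⟨y, hz, hy⟩⟩

theorem tagged_congr {D E : Set (ℕ × Baire)} {z : Baire}
    (hz : (z 0, z.tail) ∈ D ↔ (z 0, z.tail) ∈ E) : tagged f D z = tagged f E z := by
  ext y; simp [tagged, hz]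

theorem tagged_weihrauchLE (f : Problem) (D : Set (ℕ × Baire)) : (tagged f D).WeihrauchLE f :=
  .intro Baire.tail Baire.snd .tail .snd (fun _ hz => (mem_dom_tagged.1 hz).2)
    fun _ hz q hq => ⟨(mem_dom_tagged.1 hz).1, by simpa using hq⟩

theorem weihrauchLE_tagged (f : Problem) (m : ℕ) : f.WeihrauchLE (tagged f {a | a.1 = m}) :=
  .intro (cons m) Baire.snd (.cons m) .snd (fun _ hx => mem_dom_tagged.2 ⟨rfl, hx⟩)
    fun _ _ q hq => by simpa using hq.2

/-- As the tag `m` is fresh, the first entry tells the new instance from the old ones, and the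
problem splits as a join. This keeps every stage below `h`. -/
theorem tagged_insert_weihrauchLE {D : Set (ℕ × Baire)} {m : ℕ} {x : Baire}
    (hD : (tagged f D).WeihrauchLE h) (hx : (f.restrict x).WeihrauchLE h)
    (hm : ∀ a ∈ D, a.1 ≠ m) : (tagged f (insert (m, x) D)).WeihrauchLE h := by
  refine WeihrauchLE.trans (g := (f.restrict x).join (tagged f D)) ?_ (join_weihrauchLE hx hD)
  have hnew : ∀ z ∈ (tagged f (insert (m, x) D)).dom, z 0 = m → z.tail = x ∧ x ∈ f.dom := by
    intro z hz hz0
    obtain ⟨h1 | h1, h2⟩ := mem_dom_tagged.1 hz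
    · have : z.tail = x := congrArg Prod.snd h1
      exact ⟨this, this ▸ h2⟩
    · exact (hm _ h1 hz0).elim
  have hold : ∀ z ∈ (tagged f (insert (m, x) D)).dom, z 0 ≠ m → z ∈ (tagged f D).dom := by
    intro z hz hz0
    obtain ⟨h1 | h1, h2⟩ := mem_dom_tagged.1 hz
    · exact (hz0 (congrArg Prod.fst h1)).elim
    · exact mem_dom_tagged.2 ⟨h1, h2⟩
  refine .intro (fun z => if z 0 = m then pair (const 0) z.tail else pair (const 1) z) Baire.snd
    (.ite .id (.pair (.const 0) .tail) (.pair (.const 1) .id)) .snd ?_ ?_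
  · intro z hz
    by_cases hz0 : z 0 = m
    · obtain ⟨h1, h2⟩ := hnew z hz hz0
      simp only [hz0, if_true, h1]
      exact mem_dom_join.2 (.inl ⟨x, by rw [dom_restrict h2]; rfl, rfl⟩)
    · simp only [hz0, if_false]
      exact mem_dom_join.2 (.inr ⟨z, hold z hz hz0, rfl⟩)
  · intro z hz q hq
    refine ⟨(mem_dom_tagged.1 hz).1, ?_⟩
    by_cases hz0 : z 0 = m
    · obtain ⟨h1, h2⟩ := hnew z hz hz0
      simp only [hz0, if_true, h1, join_pair_zero, restrict_self] at hq
      simpa [h1] using hq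
    · simp only [hz0, if_false, join_pair_one] at hq
      simpa using hq.2

/-- A finite stage in the construction of a problem between `h` and `f`: a set of tagged instances
of `f` and a bound on their tags. -/
structure Stage (f h : Problem) where
  /-- The tagged instances. -/
  instances : Set (ℕ × Baire)
  /-- The bound on the tags. -/
  bound : ℕ
  le_bound : ∀ a ∈ instances, a.1 ≤ bound
  weihrauchLE : (tagged f instances).WeihrauchLE h

/-- The stage `T` is an initial part of the set `E`: the elements of `E` with tags up to the bound
are those of `T`. -/
def Stage.IsInitial (T : Stage f h) (E : Set (ℕ × Baire)) : Prop :=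
  T.instances ⊆ E ∧ ∀ a ∈ E, a.1 ≤ T.bound → a ∈ T.instances

/-- One stage defeats the programs `d`, `e` both as a reduction of `f` to `h ⊔ g` and as a reduction
of `g` to `h`, where `g` is the final tagged problem. Both failures persist, since each depends on
`g` at one instance only and later stages add larger tags. -/
theorem Stage.exists_next (hfh : ¬ f.WeihrauchLE h) (hsing : ∀ x, (f.restrict x).WeihrauchLE h)
    (S : Stage f h) (d e : ℕ) : ∃ T : Stage f h, S.bound ≤ T.bound ∧ S.IsInitial T.instances ∧
      ∀ E, T.IsInitial E → (∃ p ∈ f.dom, ¬ ReducesAt d e f (h.join (tagged f E)) p) ∧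
        ∃ z ∈ (tagged f E).dom, ¬ ReducesAt d e (tagged f E) h z := by
  obtain ⟨p, hp, hpS⟩ := exists_not_reducesAt (g := h.join (tagged f S.instances))
    (fun hle => hfh (hle.trans (join_weihrauchLE (.refl h) S.weihrauchLE))) d e
  -- The instance `p` makes at most one query, whose tag is at most `N`. Adding only tags above `N`
  -- leaves the answers to it unchanged.
  obtain ⟨N, hSN, hN⟩ : ∃ N, S.bound ≤ N ∧ ∀ r ∈ functional d p, r.snd 0 ≤ N := by
    by_cases hr : ∃ r, r ∈ functional d p
    · obtain ⟨r, hr⟩ := hr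
      refine ⟨max S.bound (r.snd 0), le_max_left _ _, fun r' hr' => ?_⟩
      rw [Part.mem_unique hr' hr]
      exact le_max_right _ _
    · exact ⟨S.bound, le_rfl, fun r hr' => (hr ⟨r, hr'⟩).elim⟩
  -- All of `f` embeds under the tag `N + 1`, so some instance with this tag defeats the programs;
  -- it alone is added.
  obtain ⟨z, hz, hzh⟩ := exists_not_reducesAt (g := h)
    (fun hle => hfh ((weihrauchLE_tagged f (N + 1)).trans hle)) d e
  obtain ⟨hz0, hzf⟩ := mem_dom_tagged.1 hz
  replace hz0 : z 0 = N + 1 := hz0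
  have hle : ∀ a ∈ S.instances, a.1 ≤ N := fun a ha => (S.le_bound a ha).trans hSN
  refine ⟨⟨insert (N + 1, z.tail) S.instances, N + 1, ?_, tagged_insert_weihrauchLE S.weihrauchLE
    (hsing _) fun a ha => ?_⟩, hSN.trans N.le_succ, ⟨subset_insert _ _, ?_⟩, ?_⟩
  · rintro a (rfl | ha)
    · exact le_rfl
    · exact (hle a ha).trans N.le_succ
  · exact (Nat.lt_succ_of_le (hle a ha)).ne
  · rintro a (rfl | ha) hab
    · exact absurd (hab.trans hSN) (Nat.not_succ_le_self N)
    · exact ha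
  · rintro E ⟨hTE, hET⟩
    have hzE : (z 0, z.tail) ∈ E := hTE (.inl (by rw [hz0]))
    refine ⟨⟨p, hp, fun hred => hpS (hred.congr rfl fun r hr => ?_)⟩,
      z, mem_dom_tagged.2 ⟨hzE, hzf⟩, fun hred => hzh (hred.congr ?_ fun _ _ => rfl)⟩
    · have hiff : (r.snd 0, r.snd.tail) ∈ E ↔ (r.snd 0, r.snd.tail) ∈ S.instances := by
        refine ⟨fun hr' => ?_, fun hr' => hTE (.inr hr')⟩
        rcases hET _ hr' ((hN r hr).trans N.le_succ) with h1 | h1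
        · have h2 : r.snd 0 = N + 1 := congrArg Prod.fst h1
          exact absurd (hN r hr) (by omega)
        · exact h1
      have hr1 : ∀ x, r = pair (const 1) x →
          tagged f E x = tagged f S.instances x := by
        rintro x rfl
        exact tagged_congr (by simpa using hiff)
      ext y
      refine or_congr Iff.rfl (exists_congr fun x => and_congr_right fun hx => ?_)
      rw [hr1 x hx]
    · exact tagged_congr (iff_of_true hzE hz0)

/-- Every minimal cover of `h` has an instance which does not reduce to `h`. -/
theorem IsMinimalCover.exists_restrict (hf : f.IsMinimalCover h) :
    ∃ x, ¬ (f.restrict x).WeihrauchLE h := by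
  by_contra! hsing
  choose next hbound hinit hnext using
    fun (S : Stage f h) (n : ℕ) => S.exists_next hf.1.2 hsing n.unpair.1 n.unpair.2
  have hempty : (tagged f ∅).WeihrauchLE h :=
    .intro _ _ .id .id (fun _ hz => (mem_dom_tagged.1 hz).1.elim)
      fun _ hz => (mem_dom_tagged.1 hz).1.elim
  let S : ℕ → Stage f h := fun n =>
    Nat.rec ⟨∅, 0, fun _ ha => ha.elim, hempty⟩ (fun n T => next T n) n
  have hS : ∀ n, S (n + 1) = next (S n) n := fun _ => rfl
  have hmono : Monotone fun n => (S n).instances :=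
    monotone_nat_of_le_succ fun n => (hinit (S n) n).1
  have hbmono : Monotone fun n => (S n).bound := monotone_nat_of_le_succ fun n => hbound (S n) n
  have hE : ∀ n, (S n).IsInitial (⋃ k, (S k).instances) := by
    refine fun n => ⟨subset_iUnion (fun k => (S k).instances) n, fun a ha hab => ?_⟩
    obtain ⟨k, hk⟩ := mem_iUnion.1 ha
    -- An element entering after stage `n` with a tag within the bound of stage `n` is traced back
    -- step by step, bounds being monotone.
    rcases le_total k n with hkn | hnk
    · exact hmono hkn hk
    · induction k, hnk using Nat.le_induction with
      | base => exact hk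
      | succ k hnk ih => exact ih ((hinit (S k) k).2 a hk (hab.trans (hbmono hnk)))
  have hfail := fun d e => hnext (S (Nat.pair d e)) (Nat.pair d e) _ (hE (Nat.pair d e + 1))
  simp only [Nat.unpair_pair] at hfail
  -- Either alternative is witnessed by some programs `d`, `e`, and stage `Nat.pair d e` has ruled
  -- out both.
  rcases hf.le_or_le_join (tagged_weihrauchLE f (⋃ k, (S k).instances)) with
    ⟨d, e, H⟩ | ⟨d, e, H⟩
  · obtain ⟨-, z, hz, hzh⟩ := hfail d e
    exact hzh (H z hz)
  · obtain ⟨⟨p, hp, hph⟩, -⟩ := hfail d e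
    exact hph (H p hp)

end Problem

end

theorem mainTheorem1 (f h : Problem) :
    f.IsMinimalCover h ↔
      ∃ p : Baire, f.WeihrauchEquiv (h.join (Problem.idRestrict {p})) ∧
        ¬ MedvedevLE h.dom {p} ∧ MedvedevLE h.dom (medvedevSucc p) := by
  constructor
  · intro hf
    obtain ⟨x, hx⟩ := hf.exists_restrict
    exact ⟨x, hf.exists_weihrauchEquiv_of_restrict hx⟩
  · rintro ⟨p, hf, hp, hsucc⟩
    exact Problem.isMinimalCover_of_weihrauchEquiv hf hp hsucc
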